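/- For complex numbers $z,q$ with $|q|<1$ put $(z;q)_\infty=\prod_{j=0}^\infty(1-zq^j)$ and $(cz^{\pm1};q)_\infty=(cz;q)_\infty(cz^{-1};q)_\infty$. Let $q\in\mathbb{C}$ with $|q|<1$, fix any sixth root $q^{1/6}$ of $q$, and set $q^{m/6}=(q^{1/6})^m$ for integers $m\ge 0$. The superconformal index of the three-dimensional $\mathcal{N}=2$ theory with gauge group $U(1)$, $N_f=1$ and R-charge $1/3$ is $$I_{e,N_f=1}=\sum_{k\in\mathbb{Z}} q^{|k|/3}\int_{\mathbb{T}} \frac{(q^{5/6+|k|/2}z^{\pm1};q)_\infty}{(q^{1/6+|k|/2}z^{\pm1};q)_\infty}\,\frac{dz}{2\pi \mathrm{i} z},$$ where $\mathbb{T}$ is the positively oriented unit circle, and the superconformal index of its mirror partner is $$I_{m,N_f=1}=\frac{(q^{2/3};q)_\infty^3}{(q^{1/3};q)_\infty^3}.$$ Then every integrand is integrable on $\mathbb{T}$, the sum over $k$ converges absolutely, and $I_{e,N_f=1}=I_{m,N_f=1}$. -/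

import Mathlib

noncomputable section

/-- The infinite `q`-product `(z; q)_∞ = ∏_{j ≥ 0} (1 - z q ^ j)`, used for `‖q‖ < 1`. -/
def qPochInf (z q : ℂ) : ℂ := ∏' j : ℕ, (1 - z * q ^ j)

/-- For `‖q‖ < 1` the product defining `(z; q)_∞` converges (absolutely). -/
theorem multipliable_qPochInf (z q : ℂ) (hq : ‖q‖ < 1) :
    Multipliable fun j : ℕ => 1 - z * q ^ j := by
  have h : Summable fun j : ℕ => ‖-(z * q ^ j)‖ := by
    simpa [norm_mul, norm_pow] using
      (summable_geometric_of_lt_one (norm_nonneg q) hq).mul_left ‖z‖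
  simpa [sub_eq_add_neg] using multipliable_one_add_of_summable h

/-- The notation `(c z^{±1}; q)_∞ = (c z; q)_∞ (c z⁻¹; q)_∞`. -/
def qPochInfPM (c z q : ℂ) : ℂ := qPochInf (c * z) q * qPochInf (c * z⁻¹) q

/-- The integrand in the sector of flux `k` (including the factor `1 / z` of the measure
`dz / (2 π i z)`):
`(q^{5/6+|k|/2} z^{±1}; q)_∞ / (q^{1/6+|k|/2} z^{±1}; q)_∞ · 1 / z`.
Here `r` is a sixth root of `q`, and `q^{m/6}` is read as `r ^ m`. -/
def electricIntegrand (q r : ℂ) (k : ℤ) (z : ℂ) : ℂ :=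
  qPochInfPM (r ^ (5 + 3 * k.natAbs)) z q / qPochInfPM (r ^ (1 + 3 * k.natAbs)) z q / z

/-- The contribution of flux `k`: `q^{|k|/3} ∫_𝕋 … dz / (2 π i z)`, with `𝕋` the positively
oriented unit circle. -/
def electricTerm (q r : ℂ) (k : ℤ) : ℂ :=
  r ^ (2 * k.natAbs) *
    ((2 * (Real.pi : ℂ) * Complex.I)⁻¹ * ∮ z in C(0, 1), electricIntegrand q r k z)

/-- The superconformal index of the `U(1)` theory with one flavour and R-charge `1/3`. -/
def electricIndex (q r : ℂ) : ℂ := ∑' k : ℤ, electricTerm q r k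

/-- The superconformal index of the mirror theory, `(q^{2/3}; q)_∞^3 / (q^{1/3}; q)_∞^3`. -/
def mirrorIndex (q r : ℂ) : ℂ := qPochInf (r ^ 4) q ^ 3 / qPochInf (r ^ 2) q ^ 3

end

/-! Write $r=q^{1/6}$. On the unit circle both factors
$(q^{2/3}wz^{\pm1};q)_\infty/(wz^{\pm1};q)_\infty$ with $w=r^{1+3|k|}$ expand by the $q$-binomial
theorem, and integration against $dz/z$ keeps the diagonal $\sum_m c_m^2w^{2m}$, where
$c_m=(q^{2/3};q)_m/(q;q)_m$. The double series over $(k,m)$ converges absolutely, so $k$ may be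
summed first: its dependence is $y^{|k|}$ with $y=q^{1/3+m}$, giving $(1+y)/(1-y)=(1-y^2)/(1-y)^2$.
The numerator is a very-well-poised factor, and what remains is a ${}_6\phi_5$ with $a=b=q^{2/3}$,
$c=d=x=q^{1/3}$. Rogers' summation evaluates it as the mirror index (`hasSum_mirrorIndex`). Rogers'
sum and the $q$-binomial theorem are proved alike: a first-order $q$-difference equation is iterated
and the limit taken by dominated convergence. For Rogers' sum that equation comes from telescoping
(`wellPoisedTerm_telescope`). -/

open Filter Topology Finset

/-! ### Shifted factorials: identities and uniform bounds. -/

/-- The finite `q`-shifted factorial `(z; q)_m = ∏_{j < m} (1 - z q ^ j)`. -/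
def qPoch (z q : ℂ) (m : ℕ) : ℂ := ∏ j ∈ range m, (1 - z * q ^ j)

@[simp] theorem qPoch_zero (z q : ℂ) : qPoch z q 0 = 1 := by simp [qPoch]

theorem qPoch_succ (z q : ℂ) (m : ℕ) : qPoch z q (m + 1) = qPoch z q m * (1 - z * q ^ m) := by
  simp [qPoch, prod_range_succ]

theorem qPoch_add (z q : ℂ) (n m : ℕ) :
    qPoch z q (n + m) = qPoch z q n * qPoch (z * q ^ n) q m := by
  simp [qPoch, prod_range_add, pow_add, mul_assoc]

theorem one_sub_mul_qPoch_mul (z q : ℂ) (m : ℕ) :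
    (1 - z) * qPoch (z * q) q m = qPoch z q m * (1 - z * q ^ m) := by
  rw [← qPoch_succ, add_comm, qPoch_add, qPoch_succ]
  simp

theorem qPoch_ne_zero {z q : ℂ} (hz : ∀ j : ℕ, 1 - z * q ^ j ≠ 0) (m : ℕ) : qPoch z q m ≠ 0 :=
  prod_ne_zero_iff.2 fun j _ => hz j

theorem one_sub_mul_pow_ne_zero {z q : ℂ} (hz : ‖z‖ < 1) (hq : ‖q‖ < 1) (j : ℕ) :
    1 - z * q ^ j ≠ 0 := by
  intro h
  have h1 : ‖z * q ^ j‖ < 1 := by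
    rw [norm_mul, norm_pow]
    exact mul_lt_one_of_nonneg_of_lt_one_left (norm_nonneg _) hz
      (pow_le_one₀ (norm_nonneg _) hq.le)
  rw [← sub_eq_zero.1 h] at h1
  simp at h1

theorem tendsto_qPoch (z : ℂ) {q : ℂ} (hq : ‖q‖ < 1) :
    Tendsto (qPoch z q) atTop (𝓝 (qPochInf z q)) :=
  (multipliable_qPochInf z q hq).tendsto_prod_tprod_nat

theorem qPochInf_ne_zero {z q : ℂ} (hq : ‖q‖ < 1) (hz : ∀ j : ℕ, 1 - z * q ^ j ≠ 0) :
    qPochInf z q ≠ 0 := by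
  have h : Summable fun j : ℕ => ‖-(z * q ^ j)‖ := by
    simpa [norm_mul, norm_pow] using
      (summable_geometric_of_lt_one (norm_nonneg q) hq).mul_left ‖z‖
  simpa [qPochInf, sub_eq_add_neg] using
    tprod_one_add_ne_zero_of_summable (f := fun j : ℕ => -(z * q ^ j))
      (fun j => by simpa [sub_eq_add_neg] using hz j) h

theorem qPochInf_eq_one_sub_mul (z : ℂ) {q : ℂ} (hq : ‖q‖ < 1) :
    qPochInf z q = (1 - z) * qPochInf (z * q) q := by
  refine tendsto_nhds_unique ((tendsto_add_atTop_iff_nat 1).2 (tendsto_qPoch z hq)) ?_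
  refine ((tendsto_qPoch (z * q) hq).const_mul (1 - z)).congr fun m => ?_
  rw [one_sub_mul_qPoch_mul, qPoch_succ]

theorem norm_qPoch_le (z : ℂ) {q : ℂ} (hq : ‖q‖ < 1) (m : ℕ) :
    ‖qPoch z q m‖ ≤ Real.exp (‖z‖ * (1 - ‖q‖)⁻¹) := by
  rw [qPoch, norm_prod]
  calc ∏ j ∈ range m, ‖1 - z * q ^ j‖
      ≤ ∏ j ∈ range m, Real.exp (‖z‖ * ‖q‖ ^ j) := by
        refine prod_le_prod (fun _ _ => norm_nonneg _) fun j _ => ?_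
        calc ‖1 - z * q ^ j‖ ≤ 1 + ‖z‖ * ‖q‖ ^ j := by
              simpa using norm_sub_le 1 (z * q ^ j)
          _ ≤ _ := by rw [add_comm]; exact Real.add_one_le_exp _
    _ = Real.exp (‖z‖ * ∑ j ∈ range m, ‖q‖ ^ j) := by rw [← Real.exp_sum, mul_sum]
    _ ≤ _ := by
        gcongr
        rw [← tsum_geometric_of_lt_one (norm_nonneg q) hq]
        exact (summable_geometric_of_lt_one (norm_nonneg q) hq).sum_le_tsum _
          fun _ _ => by positivity

theorem norm_mul_pow_le (z : ℂ) {q : ℂ} (hq : ‖q‖ < 1) (n : ℕ) : ‖z * q ^ n‖ ≤ ‖z‖ := by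
  rw [norm_mul, norm_pow]
  exact mul_le_of_le_one_right (norm_nonneg _) (pow_le_one₀ (norm_nonneg _) hq.le)

theorem exists_norm_qPoch_mul_pow_le (z : ℂ) {q : ℂ} (hq : ‖q‖ < 1) :
    ∃ C : ℝ, 0 < C ∧ ∀ n m, ‖qPoch (z * q ^ n) q m‖ ≤ C := by
  refine ⟨_, Real.exp_pos (‖z‖ * (1 - ‖q‖)⁻¹), fun n m => (norm_qPoch_le _ hq m).trans ?_⟩
  have : 0 < 1 - ‖q‖ := by linarith
  have := norm_mul_pow_le z hq n
  gcongr

theorem exists_norm_qPoch_mul_pow_inv_le {z q : ℂ} (hq : ‖q‖ < 1)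
    (hz : ∀ j : ℕ, 1 - z * q ^ j ≠ 0) :
    ∃ C : ℝ, 0 < C ∧ ∀ n m, ‖(qPoch (z * q ^ n) q m)⁻¹‖ ≤ C := by
  obtain ⟨C, hC, h⟩ := exists_norm_qPoch_mul_pow_le z hq
  have hb := ((tendsto_qPoch z hq).inv₀ (qPochInf_ne_zero hq hz)).norm.bddAbove_range
  obtain ⟨K, hK⟩ := hb
  have hK' : ∀ m, ‖(qPoch z q m)⁻¹‖ ≤ K := fun m => hK ⟨m, rfl⟩
  have hK0 : 0 < K := by
    have := hK' 0
    simp at this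
    linarith
  refine ⟨C * K, by positivity, fun n m => ?_⟩
  -- Splitting $(z;q)_{n+m}$ at $n$ turns a bound at the single base point $z$ into one uniform over
  -- all shifts $zq^n$.
  have e : (qPoch (z * q ^ n) q m)⁻¹ = qPoch z q n * (qPoch z q (n + m))⁻¹ := by
    have := qPoch_ne_zero hz n
    have h2 := qPoch_ne_zero hz (n + m)
    rw [qPoch_add] at h2 ⊢
    have := right_ne_zero_of_mul h2
    field_simp
  rw [e, norm_mul]
  gcongr
  · simpa using h 0 n
  · exact hK' _

/-! ### The $q$-binomial theorem. -/

/-- The coefficient `(a; q)_m / (q; q)_m` of the `q`-binomial series. -/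
noncomputable def qBinomCoeff (a q : ℂ) (m : ℕ) : ℂ := qPoch a q m / qPoch q q m

theorem qBinomCoeff_succ (a : ℂ) {q : ℂ} (hq : ‖q‖ < 1) (m : ℕ) :
    qBinomCoeff a q (m + 1) * (1 - q ^ (m + 1)) = qBinomCoeff a q m * (1 - a * q ^ m) := by
  have h := qPoch_ne_zero (one_sub_mul_pow_ne_zero hq hq) m
  have h1 := one_sub_mul_pow_ne_zero hq hq m
  rw [qBinomCoeff, qBinomCoeff, qPoch_succ, qPoch_succ, pow_succ' q m]
  generalize 1 - q * q ^ m = y at *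
  field_simp

theorem exists_norm_qBinomCoeff_le (a : ℂ) {q : ℂ} (hq : ‖q‖ < 1) :
    ∃ C : ℝ, 0 < C ∧ ∀ m, ‖qBinomCoeff a q m‖ ≤ C := by
  obtain ⟨C, hC, h⟩ := exists_norm_qPoch_mul_pow_le a hq
  obtain ⟨K, hK, h'⟩ := exists_norm_qPoch_mul_pow_inv_le hq (one_sub_mul_pow_ne_zero hq hq)
  refine ⟨C * K, by positivity, fun m => ?_⟩
  rw [qBinomCoeff, div_eq_mul_inv, norm_mul]
  gcongr
  · simpa using h 0 m
  · simpa using h' 0 m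

theorem summable_norm_qBinomCoeff_mul_pow (a : ℂ) {q z : ℂ} (hq : ‖q‖ < 1) (hz : ‖z‖ < 1) :
    Summable fun m => ‖qBinomCoeff a q m * z ^ m‖ := by
  obtain ⟨C, hC, h⟩ := exists_norm_qBinomCoeff_le a hq
  refine ((summable_geometric_of_lt_one (norm_nonneg z) hz).mul_left C).of_nonneg_of_le
    (fun _ => norm_nonneg _) fun m => ?_
  rw [norm_mul, norm_pow]
  gcongr
  exact h m

/-- Comparing coefficients in $F(z)-F(qz)$, the two-term recurrence for the coefficients becomes a
$q$-difference equation for the generating function $F$. -/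
theorem one_sub_mul_tsum_qBinomCoeff (a : ℂ) {q z : ℂ} (hq : ‖q‖ < 1) (hz : ‖z‖ < 1) :
    (1 - z) * ∑' m, qBinomCoeff a q m * z ^ m =
      (1 - a * z) * ∑' m, qBinomCoeff a q m * (z * q) ^ m := by
  have hzq : ‖z * q‖ < 1 := by simpa using (norm_mul_pow_le z hq 1).trans_lt hz
  have h1 := (summable_norm_qBinomCoeff_mul_pow a hq hz).of_norm
  have h2 := (summable_norm_qBinomCoeff_mul_pow a hq hzq).of_norm
  have e1 := (h1.sub h2).tsum_eq_zero_add
  have e2 : ∀ m, qBinomCoeff a q (m + 1) * z ^ (m + 1) - qBinomCoeff a q (m + 1) * (z * q) ^ (m + 1)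
      = z * (qBinomCoeff a q m * z ^ m) - a * z * (qBinomCoeff a q m * (z * q) ^ m) := by
    intro m
    rw [mul_pow, mul_pow]
    linear_combination z ^ (m + 1) * qBinomCoeff_succ a hq m
  simp only [e2] at e1
  rw [h1.tsum_sub h2, (h1.mul_left z).tsum_sub (h2.mul_left (a * z)), tsum_mul_left,
    tsum_mul_left] at e1
  simp at e1
  linear_combination e1

theorem qPoch_mul_tsum_qBinomCoeff (a : ℂ) {q z : ℂ} (hq : ‖q‖ < 1) (hz : ‖z‖ < 1) (n : ℕ) :
    qPoch z q n * ∑' m, qBinomCoeff a q m * z ^ m =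
      qPoch (a * z) q n * ∑' m, qBinomCoeff a q m * (z * q ^ n) ^ m := by
  induction n with
  | zero => simp
  | succ n ih =>
    have h := one_sub_mul_tsum_qBinomCoeff a hq ((norm_mul_pow_le z hq n).trans_lt hz)
    rw [qPoch_succ, qPoch_succ, pow_succ, ← mul_assoc z]
    linear_combination (1 - z * q ^ n) * ih + qPoch (a * z) q n * h

theorem tendsto_mul_pow_zero (z : ℂ) {q : ℂ} (hq : ‖q‖ < 1) :
    Tendsto (fun n : ℕ => z * q ^ n) atTop (𝓝 0) := by
  simpa using (tendsto_pow_atTop_nhds_zero_of_norm_lt_one hq).const_mul z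

/-- The `q`-binomial theorem. -/
theorem hasSum_qBinomCoeff (a : ℂ) {q z : ℂ} (hq : ‖q‖ < 1) (hz : ‖z‖ < 1) :
    HasSum (fun m => qBinomCoeff a q m * z ^ m) (qPochInf (a * z) q / qPochInf z q) := by
  have hsum := summable_norm_qBinomCoeff_mul_pow a hq hz
  have hlim : Tendsto (fun n : ℕ => ∑' m, qBinomCoeff a q m * (z * q ^ n) ^ m) atTop
      (𝓝 (∑' m, qBinomCoeff a q m * 0 ^ m)) := by
    refine tendsto_tsum_of_dominated_convergence hsum
      (fun m => ((tendsto_mul_pow_zero z hq).pow m).const_mul _) (.of_forall fun n m => ?_)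
    rw [norm_mul, norm_mul, norm_pow, norm_pow]
    have := norm_mul_pow_le z hq n
    gcongr
  have h0 : ∑' m, qBinomCoeff a q m * (0 : ℂ) ^ m = 1 := by
    rw [tsum_eq_single 0 (fun m hm => by simp [hm])]
    simp [qBinomCoeff]
  rw [h0] at hlim
  have h := tendsto_nhds_unique
    (((tendsto_qPoch z hq).mul_const _).congr fun n => qPoch_mul_tsum_qBinomCoeff a hq hz n)
    ((tendsto_qPoch (a * z) hq).mul hlim)
  have hne := qPochInf_ne_zero hq (one_sub_mul_pow_ne_zero hz hq)
  rw [show qPochInf (a * z) q / qPochInf z q = ∑' m, qBinomCoeff a q m * z ^ m by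
    rw [div_eq_iff hne]; linear_combination -h]
  exact hsum.of_norm.hasSum

/-! ### Rogers' very-well-poised ${}_6\phi_5$ sum. -/

/-- The summand of the very-well-poised series `₆φ₅` with parameters `a, b, c, d` and argument `x`,
without the very-well-poised factor. For `a * q = x * b * c * d` the lower parameters
`a q / b`, `a q / c`, `a q / d` are `x c d`, `x b d`, `x b c`. -/
noncomputable def wellPoisedTerm (q b c d a x : ℂ) (m : ℕ) : ℂ :=
  qPoch a q m * qPoch b q m * qPoch c q m * qPoch d q m *
    ((qPoch q q m)⁻¹ * (qPoch (x * c * d) q m)⁻¹ * (qPoch (x * b * d) q m)⁻¹ *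
      (qPoch (x * b * c) q m)⁻¹) * x ^ m

/-- The constant does not depend on the shift $n$, so this bound supplies the dominating series for
the limit $n\to\infty$. -/
theorem exists_norm_wellPoisedTerm_le {q b c d x : ℂ} (a : ℂ) (hq : ‖q‖ < 1)
    (hb : ∀ j : ℕ, 1 - x * c * d * q ^ j ≠ 0) (hc : ∀ j : ℕ, 1 - x * b * d * q ^ j ≠ 0)
    (hd : ∀ j : ℕ, 1 - x * b * c * q ^ j ≠ 0) :
    ∃ K : ℝ, 0 < K ∧ ∀ n m,
      ‖wellPoisedTerm q b c d (a * q ^ n) (x * q ^ n) m‖ ≤ K * ‖x * q ^ n‖ ^ m := by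
  obtain ⟨C1, p1, h1⟩ := exists_norm_qPoch_mul_pow_le a hq
  obtain ⟨C2, p2, h2⟩ := exists_norm_qPoch_mul_pow_le b hq
  obtain ⟨C3, p3, h3⟩ := exists_norm_qPoch_mul_pow_le c hq
  obtain ⟨C4, p4, h4⟩ := exists_norm_qPoch_mul_pow_le d hq
  obtain ⟨K1, q1, k1⟩ := exists_norm_qPoch_mul_pow_inv_le hq (one_sub_mul_pow_ne_zero hq hq)
  obtain ⟨K2, q2, k2⟩ := exists_norm_qPoch_mul_pow_inv_le hq hb
  obtain ⟨K3, q3, k3⟩ := exists_norm_qPoch_mul_pow_inv_le hq hc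
  obtain ⟨K4, q4, k4⟩ := exists_norm_qPoch_mul_pow_inv_le hq hd
  refine ⟨C1 * C2 * C3 * C4 * (K1 * K2 * K3 * K4), by positivity, fun n m => ?_⟩
  have h2 := h2 0 m
  have h3 := h3 0 m
  have h4 := h4 0 m
  have k1 := k1 0 m
  have k2 := k2 n m
  have k3 := k3 n m
  have k4 := k4 n m
  simp only [pow_zero, mul_one] at h2 h3 h4 k1
  rw [mul_right_comm _ _ (q ^ n), mul_right_comm x _ (q ^ n)] at k2 k3 k4
  simp only [wellPoisedTerm, norm_mul _ (_ ^ m), norm_pow _ m]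
  refine mul_le_mul_of_nonneg_right ?_ (by positivity)
  simp only [norm_mul (_ * _), norm_mul (qPoch _ _ _), norm_mul (qPoch _ _ _)⁻¹]
  have h1 := h1 n m
  gcongr

theorem wellPoisedTerm_succ {q b c d a x : ℂ} (hq : ‖q‖ < 1)
    (hb : ∀ j : ℕ, 1 - x * c * d * q ^ j ≠ 0) (hc : ∀ j : ℕ, 1 - x * b * d * q ^ j ≠ 0)
    (hd : ∀ j : ℕ, 1 - x * b * c * q ^ j ≠ 0) (m : ℕ) :
    wellPoisedTerm q b c d a x (m + 1) * ((1 - q * q ^ m) * ((1 - x * c * d * q ^ m) *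
      (1 - x * b * d * q ^ m) * (1 - x * b * c * q ^ m))) =
    wellPoisedTerm q b c d a x m * (x * (1 - a * q ^ m) * (1 - b * q ^ m) * (1 - c * q ^ m) *
      (1 - d * q ^ m)) := by
  have n1 := one_sub_mul_pow_ne_zero hq hq m
  have n2 := hb m
  have n3 := hc m
  have n4 := hd m
  simp only [wellPoisedTerm, qPoch_succ, mul_inv, pow_succ x]
  calc _ = (qPoch a q m * qPoch b q m * qPoch c q m * qPoch d q m * ((qPoch q q m)⁻¹ *
        (qPoch (x * c * d) q m)⁻¹ * (qPoch (x * b * d) q m)⁻¹ * (qPoch (x * b * c) q m)⁻¹) *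
        x ^ m * (x * (1 - a * q ^ m) * (1 - b * q ^ m) * (1 - c * q ^ m) * (1 - d * q ^ m))) *
        ((1 - q * q ^ m)⁻¹ * (1 - q * q ^ m)) *
        ((1 - x * c * d * q ^ m)⁻¹ * (1 - x * c * d * q ^ m)) *
        ((1 - x * b * d * q ^ m)⁻¹ * (1 - x * b * d * q ^ m)) *
        ((1 - x * b * c * q ^ m)⁻¹ * (1 - x * b * c * q ^ m)) := by
        generalize (1 - q * q ^ m)⁻¹ = z1
        generalize (1 - x * c * d * q ^ m)⁻¹ = z2
        generalize (1 - x * b * d * q ^ m)⁻¹ = z3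
        generalize (1 - x * b * c * q ^ m)⁻¹ = z4
        ring
    _ = _ := by
        rw [inv_mul_cancel₀ n1, inv_mul_cancel₀ n2, inv_mul_cancel₀ n3, inv_mul_cancel₀ n4]
        simp only [mul_one]

theorem inv_qPoch_mul {z q : ℂ} (hz : ∀ j : ℕ, 1 - z * q ^ j ≠ 0) (m : ℕ) :
    (qPoch (z * q) q m)⁻¹ * (1 - z * q ^ m) = (qPoch z q m)⁻¹ * (1 - z) := by
  have h1 := one_sub_mul_qPoch_mul z q m
  have h2 := qPoch_ne_zero hz m
  have h3 : qPoch (z * q) q m ≠ 0 :=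
    qPoch_ne_zero (fun j => by simpa [pow_succ', mul_assoc] using hz (j + 1)) m
  field_simp
  linear_combination -h1

theorem one_sub_mul_wellPoisedTerm_mul {q b c d a x : ℂ}
    (hb : ∀ j : ℕ, 1 - x * c * d * q ^ j ≠ 0) (hc : ∀ j : ℕ, 1 - x * b * d * q ^ j ≠ 0)
    (hd : ∀ j : ℕ, 1 - x * b * c * q ^ j ≠ 0) (m : ℕ) :
    (1 - a) * wellPoisedTerm q b c d (a * q) (x * q) m * ((1 - x * c * d * q ^ m) *
      (1 - x * b * d * q ^ m) * (1 - x * b * c * q ^ m)) =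
    wellPoisedTerm q b c d a x m * ((1 - a * q ^ m) * q ^ m *
      ((1 - x * c * d) * (1 - x * b * d) * (1 - x * b * c))) := by
  have e1 := inv_qPoch_mul hb m
  have e2 := inv_qPoch_mul hc m
  have e3 := inv_qPoch_mul hd m
  have e0 := one_sub_mul_qPoch_mul a q m
  simp only [wellPoisedTerm, mul_pow, mul_right_comm x q, mul_right_comm (x * _) q]
  calc _ = ((1 - a) * qPoch (a * q) q m) * (qPoch b q m * qPoch c q m * qPoch d q m *
        (qPoch q q m)⁻¹ * (x ^ m * q ^ m)) *
        ((qPoch (x * c * d * q) q m)⁻¹ * (1 - x * c * d * q ^ m)) *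
        ((qPoch (x * b * d * q) q m)⁻¹ * (1 - x * b * d * q ^ m)) *
        ((qPoch (x * b * c * q) q m)⁻¹ * (1 - x * b * c * q ^ m)) := by ring
    _ = _ := by rw [e0, e1, e2, e3]; ring

/-- A WZ-type certificate: the shift $(a,x)\mapsto(aq,xq)$ preserves $aq=xbcd$, and the weighted
difference of the two summands is a difference in $m$ of $G(m)=(1-q^m)(1-axq^m)\,T(m)$, up to a
constant, where $T$ is the unshifted `wellPoisedTerm`. -/
theorem wellPoisedTerm_telescope {q b c d a x : ℂ} (hq : ‖q‖ < 1) (h : a * q = x * b * c * d)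
    (hb : ∀ j : ℕ, 1 - x * c * d * q ^ j ≠ 0) (hc : ∀ j : ℕ, 1 - x * b * d * q ^ j ≠ 0)
    (hd : ∀ j : ℕ, 1 - x * b * c * q ^ j ≠ 0) (m : ℕ) :
    (1 - x) * ((1 - x * c * d) * (1 - x * b * d) * (1 - x * b * c)) *
        ((1 - a * (q ^ m) ^ 2) * wellPoisedTerm q b c d a x m) -
      (1 - a) * ((1 - x * b) * (1 - x * c) * (1 - x * d)) *
        ((1 - a * q * (q ^ m) ^ 2) * wellPoisedTerm q b c d (a * q) (x * q) m) =
    (1 - x * c * d) * (1 - x * b * d) * (1 - x * b * c) *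
      ((1 - q ^ m) * (1 - a * x * q ^ m) * wellPoisedTerm q b c d a x m -
        (1 - q ^ (m + 1)) * (1 - a * x * q ^ (m + 1)) * wellPoisedTerm q b c d a x (m + 1)) := by
  have e1 := wellPoisedTerm_succ (a := a) hq hb hc hd m
  have e2 := one_sub_mul_wellPoisedTerm_mul (a := a) hb hc hd m
  have hne : (1 - x * c * d * q ^ m) * (1 - x * b * d * q ^ m) * (1 - x * b * c * q ^ m) ≠ 0 :=
    mul_ne_zero (mul_ne_zero (hb m) (hc m)) (hd m)
  have e3 : a * x * q ^ (m + 1) = x * (x * b * c * d) * q ^ m := by rw [← h]; ring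
  rw [e3, h]
  rw [h] at e2
  rw [pow_succ' q m]
  -- With $aq$ replaced by $xbcd$, the ratios `e1` and `e2` leave only a polynomial identity, in
  -- which $q^m$ is a free variable.
  generalize wellPoisedTerm q b c d a x (m + 1) = u1 at *
  generalize wellPoisedTerm q b c d a x m = u at *
  generalize wellPoisedTerm q b c d (x * b * c * d) (x * q) m = v at *
  generalize q ^ m = Q at *
  apply mul_right_cancel₀ hne
  linear_combination (-((1 - x * b) * (1 - x * c) * (1 - x * d)) *
    (1 - x * b * c * d * Q ^ 2)) * e2 +
    (1 - x * c * d) * (1 - x * b * d) * (1 - x * b * c) * (1 - x * (x * b * c * d) * Q) * e1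

theorem summable_wellPoisedTerm {q b c d x : ℂ} (a : ℂ) (hq : ‖q‖ < 1) (hx : ‖x‖ < 1)
    (hb : ∀ j : ℕ, 1 - x * c * d * q ^ j ≠ 0) (hc : ∀ j : ℕ, 1 - x * b * d * q ^ j ≠ 0)
    (hd : ∀ j : ℕ, 1 - x * b * c * q ^ j ≠ 0) : Summable (wellPoisedTerm q b c d a x) := by
  obtain ⟨K, hK, h⟩ := exists_norm_wellPoisedTerm_le a hq hb hc hd
  refine .of_norm_bounded ((summable_geometric_of_lt_one (norm_nonneg x) hx).mul_left K)
    fun m => ?_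
  simpa using h 0 m

theorem summable_one_sub_mul_wellPoisedTerm {q b c d x : ℂ} (a : ℂ) (hq : ‖q‖ < 1)
    (hx : ‖x‖ < 1) (hb : ∀ j : ℕ, 1 - x * c * d * q ^ j ≠ 0)
    (hc : ∀ j : ℕ, 1 - x * b * d * q ^ j ≠ 0) (hd : ∀ j : ℕ, 1 - x * b * c * q ^ j ≠ 0) :
    Summable fun m => (1 - a * (q ^ m) ^ 2) * wellPoisedTerm q b c d a x m := by
  refine .of_norm_bounded
    ((summable_wellPoisedTerm a hq hx hb hc hd).norm.mul_left (1 + ‖a‖)) fun m => ?_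
  rw [norm_mul]
  gcongr
  refine (norm_sub_le _ _).trans ?_
  rw [norm_one, ← pow_mul]
  gcongr
  exact norm_mul_pow_le a hq _

theorem one_sub_mul_pow_shift {q y z w : ℂ} (h : ∀ j : ℕ, 1 - y * z * w * q ^ j ≠ 0) (n j : ℕ) :
    1 - y * q ^ n * z * w * q ^ j ≠ 0 := by
  convert h (n + j) using 2
  ring

theorem tsum_wellPoised_recurrence {q b c d a x : ℂ} (hq : ‖q‖ < 1) (hx : ‖x‖ < 1)
    (h : a * q = x * b * c * d)
    (hb : ∀ j : ℕ, 1 - x * c * d * q ^ j ≠ 0) (hc : ∀ j : ℕ, 1 - x * b * d * q ^ j ≠ 0)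
    (hd : ∀ j : ℕ, 1 - x * b * c * q ^ j ≠ 0) :
    (1 - x) * ((1 - x * c * d) * (1 - x * b * d) * (1 - x * b * c)) *
        ∑' m, (1 - a * (q ^ m) ^ 2) * wellPoisedTerm q b c d a x m =
      (1 - a) * ((1 - x * b) * (1 - x * c) * (1 - x * d)) *
        ∑' m, (1 - a * q * (q ^ m) ^ 2) * wellPoisedTerm q b c d (a * q) (x * q) m := by
  have s1 := summable_one_sub_mul_wellPoisedTerm a hq hx hb hc hd
  have hxq : ‖x * q‖ < 1 := by simpa using (norm_mul_pow_le x hq 1).trans_lt hx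
  have s2 := summable_one_sub_mul_wellPoisedTerm (a * q) (x := x * q) hq hxq
    (fun j => by simpa using one_sub_mul_pow_shift hb 1 j)
    (fun j => by simpa using one_sub_mul_pow_shift hc 1 j)
    (fun j => by simpa using one_sub_mul_pow_shift hd 1 j)
  have hQ := tendsto_pow_atTop_nhds_zero_of_norm_lt_one hq
  have hG : Tendsto (fun m : ℕ => (1 - q ^ m) * (1 - a * x * q ^ m) * wellPoisedTerm q b c d a x m)
      atTop (𝓝 0) := by
    simpa using ((tendsto_const_nhds.sub hQ).mul (tendsto_const_nhds.sub (hQ.const_mul (a * x)))).mul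
      (summable_wellPoisedTerm a hq hx hb hc hd).tendsto_atTop_zero
  have s3 := (s1.mul_left ((1 - x) * ((1 - x * c * d) * (1 - x * b * d) * (1 - x * b * c)))).sub
    (s2.mul_left ((1 - a) * ((1 - x * b) * (1 - x * c) * (1 - x * d))))
  have key := s3.hasSum.tendsto_sum_nat
  rw [(s1.mul_left _).tsum_sub (s2.mul_left _), tsum_mul_left, tsum_mul_left] at key
  refine sub_eq_zero.1 (tendsto_nhds_unique key ?_)
  -- Both boundary terms vanish: at $m=0$ through the factor $1-q^m$, at infinity by `hG`.
  simp only [wellPoisedTerm_telescope hq h hb hc hd, ← mul_sum]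
  simp only [sum_range_sub']
  simpa using (hG.const_sub 0).const_mul ((1 - x * c * d) * (1 - x * b * d) * (1 - x * b * c))

theorem tsum_wellPoised_iterate {q b c d a x : ℂ} (hq : ‖q‖ < 1) (hx : ‖x‖ < 1)
    (h : a * q = x * b * c * d)
    (hb : ∀ j : ℕ, 1 - x * c * d * q ^ j ≠ 0) (hc : ∀ j : ℕ, 1 - x * b * d * q ^ j ≠ 0)
    (hd : ∀ j : ℕ, 1 - x * b * c * q ^ j ≠ 0) (n : ℕ) :
    qPoch x q n * (qPoch (x * c * d) q n * qPoch (x * b * d) q n * qPoch (x * b * c) q n) *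
        ∑' m, (1 - a * (q ^ m) ^ 2) * wellPoisedTerm q b c d a x m =
      qPoch a q n * (qPoch (x * b) q n * qPoch (x * c) q n * qPoch (x * d) q n) *
        ∑' m, (1 - a * q ^ n * (q ^ m) ^ 2) *
          wellPoisedTerm q b c d (a * q ^ n) (x * q ^ n) m := by
  induction n with
  | zero => simp
  | succ n ih =>
    have hr := tsum_wellPoised_recurrence (a := a * q ^ n) (x := x * q ^ n) hq
      ((norm_mul_pow_le x hq n).trans_lt hx) (by linear_combination q ^ n * h)
      (one_sub_mul_pow_shift hb n) (one_sub_mul_pow_shift hc n) (one_sub_mul_pow_shift hd n)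
    simp only [qPoch_succ, pow_succ q n, ← mul_assoc a, ← mul_assoc x]
    linear_combination (1 - x * q ^ n) * ((1 - x * c * d * q ^ n) * (1 - x * b * d * q ^ n) *
      (1 - x * b * c * q ^ n)) * ih +
      qPoch a q n * (qPoch (x * b) q n * qPoch (x * c) q n * qPoch (x * d) q n) * hr

/-- Rogers' nonterminating very-well-poised `₆φ₅` summation. -/
theorem hasSum_wellPoised {q b c d a x : ℂ} (hq : ‖q‖ < 1) (hx : ‖x‖ < 1)
    (h : a * q = x * b * c * d)
    (hb : ∀ j : ℕ, 1 - x * c * d * q ^ j ≠ 0) (hc : ∀ j : ℕ, 1 - x * b * d * q ^ j ≠ 0)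
    (hd : ∀ j : ℕ, 1 - x * b * c * q ^ j ≠ 0) :
    HasSum (fun m => (1 - a * (q ^ m) ^ 2) * wellPoisedTerm q b c d a x m)
      (qPochInf a q * (qPochInf (x * b) q * qPochInf (x * c) q * qPochInf (x * d) q) /
        (qPochInf x q *
          (qPochInf (x * c * d) q * qPochInf (x * b * d) q * qPochInf (x * b * c) q))) := by
  obtain ⟨K, hK, hle⟩ := exists_norm_wellPoisedTerm_le a hq hb hc hd
  have hlim : Tendsto (fun n : ℕ => ∑' m, (1 - a * q ^ n * (q ^ m) ^ 2) *
      wellPoisedTerm q b c d (a * q ^ n) (x * q ^ n) m) atTop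
      -- As $xq^n\to0$, only the term $m=0$ survives.
      (𝓝 (∑' m : ℕ, if m = 0 then 1 else 0)) := by
    have hfac : ∀ n m : ℕ, ‖1 - a * q ^ n * (q ^ m) ^ 2‖ ≤ 1 + ‖a‖ := fun n m => by
      refine (norm_sub_le _ _).trans ?_
      rw [norm_one, ← pow_mul, mul_assoc, ← pow_add]
      gcongr
      exact norm_mul_pow_le a hq _
    have hbd : ∀ n m : ℕ, ‖(1 - a * q ^ n * (q ^ m) ^ 2) *
        wellPoisedTerm q b c d (a * q ^ n) (x * q ^ n) m‖ ≤
        (1 + ‖a‖) * (K * ‖x * q ^ n‖ ^ m) := fun n m => by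
      rw [norm_mul]
      gcongr
      exacts [hfac n m, hle n m]
    refine tendsto_tsum_of_dominated_convergence
      (((summable_geometric_of_lt_one (norm_nonneg x) hx).mul_left K).mul_left (1 + ‖a‖))
      (fun m => ?_) (.of_forall fun n m => (hbd n m).trans ?_)
    · rcases eq_or_ne m 0 with rfl | hm
      · simpa [wellPoisedTerm] using (tendsto_mul_pow_zero a hq).const_sub 1
      · rw [if_neg hm]
        refine squeeze_zero_norm (fun n => hbd n m) ?_
        simpa [hm] using
          (((tendsto_mul_pow_zero x hq).norm.pow m).const_mul K).const_mul (1 + ‖a‖)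
    · have := norm_mul_pow_le x hq n
      gcongr
  rw [tsum_ite_eq] at hlim
  have key := tendsto_nhds_unique
    ((((tendsto_qPoch x hq).mul (((tendsto_qPoch (x * c * d) hq).mul
      (tendsto_qPoch (x * b * d) hq)).mul (tendsto_qPoch (x * b * c) hq))).mul_const _).congr
        fun n => tsum_wellPoised_iterate hq hx h hb hc hd n)
    (((tendsto_qPoch a hq).mul (((tendsto_qPoch (x * b) hq).mul
      (tendsto_qPoch (x * c) hq)).mul (tendsto_qPoch (x * d) hq))).mul hlim)
  have hne := mul_ne_zero (qPochInf_ne_zero hq (one_sub_mul_pow_ne_zero hx hq))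
    (mul_ne_zero (mul_ne_zero (qPochInf_ne_zero hq hb) (qPochInf_ne_zero hq hc))
      (qPochInf_ne_zero hq hd))
  rw [← (eq_div_iff hne).2 (show (∑' m, (1 - a * (q ^ m) ^ 2) * wellPoisedTerm q b c d a x m) * _ = _
    by linear_combination key)]
  exact (summable_one_sub_mul_wellPoisedTerm a hq hx hb hc hd).hasSum

/-! ### Termwise integration on the circle and the constant term. -/

theorem HasSum.of_eq_of_eq {ι α : Type*} [AddCommMonoid α] [TopologicalSpace α] {f g : ι → α}
    {a b : α} (h : HasSum f a) (hg : ∀ i, g i = f i) (hb : b = a) : HasSum g b := by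
  rwa [hb, funext hg]

/-- Weierstrass M-test: the sum is continuous on the circle, hence integrable, and dominated
convergence allows termwise integration. -/
theorem hasSum_circleIntegral_of_summable_norm {ι : Type*} [Countable ι] {c : ℂ} {R : ℝ}
    (hR : 0 ≤ R) {F : ι → ℂ → ℂ} {f : ℂ → ℂ} {u : ι → ℝ} (hu : Summable u)
    (hF : ∀ i, ContinuousOn (F i) (Metric.sphere c R))
    (hle : ∀ i, ∀ z ∈ Metric.sphere c R, ‖F i z‖ ≤ u i)
    (hf : ∀ z ∈ Metric.sphere c R, HasSum (fun i => F i z) (f z)) :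
    CircleIntegrable f c R ∧ HasSum (fun i => ∮ z in C(c, R), F i z) (∮ z in C(c, R), f z) := by
  constructor
  · refine ContinuousOn.circleIntegrable hR ((continuousOn_tsum hF hu hle).congr fun z hz => ?_)
    exact (hf z hz).tsum_eq.symm
  · have hmem : ∀ θ, circleMap c R θ ∈ Metric.sphere c R := fun θ => circleMap_mem_sphere c hR θ
    refine intervalIntegral.hasSum_integral_of_dominated_convergence (fun i _ => R * u i)
      (fun i => ?_) (fun i => .of_forall fun θ _ => ?_)
      (.of_forall fun θ _ => hu.mul_left R) intervalIntegrable_const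
      (.of_forall fun θ _ => (hf _ (hmem θ)).const_smul _)
    · have h1 : Continuous fun θ => F i (circleMap c R θ) :=
        (hF i).comp_continuous (continuous_circleMap c R) hmem
      have h2 : Continuous (deriv (circleMap c R)) := by
        have : deriv (circleMap c R) = fun θ => circleMap 0 R θ * Complex.I := by
          ext θ; simp
        rw [this]
        fun_prop
      exact (h2.smul h1).aestronglyMeasurable
    · rw [norm_smul]
      have := hle i _ (hmem θ)
      simp only [deriv_circleMap, norm_mul, norm_circleMap_zero, Complex.norm_I, mul_one,
        abs_of_nonneg hR]
      gcongr

theorem circleIntegral_pow_mul_inv_pow (m n : ℕ) :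
    (∮ z in C(0, 1), z ^ m * z⁻¹ ^ n * z⁻¹) = if m = n then 2 * (Real.pi : ℂ) * Complex.I else 0 := by
  have h : (∮ z in C(0, 1), z ^ m * z⁻¹ ^ n * z⁻¹) =
      ∮ z in C(0, 1), (z - 0) ^ ((m : ℤ) - n - 1) := by
    refine circleIntegral.integral_congr zero_le_one fun z hz => ?_
    have hz0 : z ≠ 0 := by
      rintro rfl
      simp at hz
    simp only [sub_zero]
    rw [zpow_sub₀ hz0, zpow_sub₀ hz0]
    simp [div_eq_mul_inv]
  rw [h]
  split_ifs with hmn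
  · subst hmn
    simpa using circleIntegral.integral_sub_center_inv 0 one_ne_zero
  · exact circleIntegral.integral_sub_zpow_of_ne (by omega) _ _ _

/-- The Laurent monomial of index `(m, n)` in the expansion of
`(a w z^{±1}; q)_∞ / (w z^{±1}; q)_∞ / z`. -/
noncomputable def qBinomLaurentTerm (a q w : ℂ) (p : ℕ × ℕ) (z : ℂ) : ℂ :=
  (qBinomCoeff a q p.1 * (w * z) ^ p.1) * (qBinomCoeff a q p.2 * (w * z⁻¹) ^ p.2) * z⁻¹

theorem norm_qBinomLaurentTerm (a q w : ℂ) (p : ℕ × ℕ) {z : ℂ} (hz : ‖z‖ = 1) :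
    ‖qBinomLaurentTerm a q w p z‖ =
      ‖qBinomCoeff a q p.1 * w ^ p.1‖ * ‖qBinomCoeff a q p.2 * w ^ p.2‖ := by
  simp [qBinomLaurentTerm, hz]

theorem continuousOn_qBinomLaurentTerm (a q w : ℂ) (p : ℕ × ℕ) :
    ContinuousOn (qBinomLaurentTerm a q w p) {0}ᶜ := by
  have h1 : ContinuousOn (fun z : ℂ => z⁻¹) {0}ᶜ := continuousOn_inv₀
  unfold qBinomLaurentTerm
  fun_prop

theorem hasSum_qBinomLaurentTerm (a : ℂ) {q w z : ℂ} (hq : ‖q‖ < 1) (hw : ‖w‖ < 1)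
    (hz : ‖z‖ = 1) :
    HasSum (fun p => qBinomLaurentTerm a q w p z)
      (qPochInfPM (a * w) z q / qPochInfPM w z q / z) := by
  have h1 : ‖w * z‖ < 1 := by simpa [hz] using hw
  have h2 : ‖w * z⁻¹‖ < 1 := by simpa [hz] using hw
  have s1 := summable_norm_qBinomCoeff_mul_pow a hq h1
  have s2 := summable_norm_qBinomCoeff_mul_pow a hq h2
  have hs := summable_mul_of_summable_norm s1 s2
  have h := ((hasSum_qBinomCoeff a hq h1).mul (hasSum_qBinomCoeff a hq h2) hs).mul_right z⁻¹
  refine h.of_eq_of_eq (fun p => by rw [qBinomLaurentTerm]) ?_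
  rw [qPochInfPM, qPochInfPM, mul_assoc a, mul_assoc a, mul_div_mul_comm, div_eq_mul_inv _ z]

theorem circleIntegral_qBinomLaurentTerm (a q w : ℂ) (p : ℕ × ℕ) :
    (∮ z in C(0, 1), qBinomLaurentTerm a q w p z) =
      qBinomCoeff a q p.1 * qBinomCoeff a q p.2 * w ^ (p.1 + p.2) *
        if p.1 = p.2 then 2 * (Real.pi : ℂ) * Complex.I else 0 := by
  rw [← circleIntegral_pow_mul_inv_pow, ← circleIntegral.integral_const_mul]
  congr 1
  ext z
  simp only [qBinomLaurentTerm, mul_pow, pow_add]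
  ring

/-- Of the double Laurent expansion only the monomials with equal powers of $z$ and $z^{-1}$ have
nonzero integral. -/
theorem hasSum_circleIntegral_qPochInfPM (a : ℂ) {q w : ℂ} (hq : ‖q‖ < 1) (hw : ‖w‖ < 1) :
    CircleIntegrable (fun z => qPochInfPM (a * w) z q / qPochInfPM w z q / z) 0 1 ∧
      HasSum (fun m => qBinomCoeff a q m ^ 2 * (w ^ 2) ^ m)
        ((2 * (Real.pi : ℂ) * Complex.I)⁻¹ *
          ∮ z in C(0, 1), qPochInfPM (a * w) z q / qPochInfPM w z q / z) := by
  have hs := summable_norm_qBinomCoeff_mul_pow a hq hw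
  have hnorm : ∀ z ∈ Metric.sphere (0 : ℂ) 1, ‖z‖ = 1 := fun z hz => by simpa using hz
  have hne : Metric.sphere (0 : ℂ) 1 ⊆ {0}ᶜ := by
    rintro z hz rfl
    simp at hz
  have hu := hs.mul_of_nonneg hs (fun _ => norm_nonneg _) fun _ => norm_nonneg _
  obtain ⟨hint, hsum⟩ := hasSum_circleIntegral_of_summable_norm zero_le_one hu
    (fun p => (continuousOn_qBinomLaurentTerm a q w p).mono hne)
    (fun p z hz => (norm_qBinomLaurentTerm a q w p (hnorm z hz)).le)
    (fun z hz => hasSum_qBinomLaurentTerm a hq hw (hnorm z hz))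
  refine ⟨hint, ?_⟩
  simp only [circleIntegral_qBinomLaurentTerm] at hsum
  have hinj : Function.Injective fun m : ℕ => (m, m) := fun m n h => congrArg Prod.fst h
  have hdiag := (hinj.hasSum_iff (fun p hp => by
    rw [if_neg, mul_zero]
    exact fun h => hp ⟨p.1, Prod.ext rfl h⟩)).2 hsum
  refine (hdiag.mul_left (2 * (Real.pi : ℂ) * Complex.I)⁻¹).of_eq_of_eq (fun m => ?_) rfl
  simp only [Function.comp_apply, if_true]
  rw [mul_comm _ (2 * (Real.pi : ℂ) * Complex.I), inv_mul_cancel_left₀ Complex.two_pi_I_ne_zero]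
  ring

/-! ### Summation over fluxes and comparison with the mirror index. -/

theorem hasSum_pow_natAbs {𝕜 : Type*} [NormedField 𝕜] [CompleteSpace 𝕜] {y : 𝕜} (hy : ‖y‖ < 1) :
    HasSum (fun k : ℤ => y ^ k.natAbs) ((1 + y) / (1 - y)) := by
  have h := hasSum_geometric_of_norm_lt_one hy
  refine (HasSum.of_nat_of_neg_add_one (f := fun k : ℤ => y ^ k.natAbs) (by simpa using h)
    (m' := y * (1 - y)⁻¹) ((h.mul_left y).of_eq_of_eq (fun n => ?_) rfl)).of_eq_of_eq
    (fun _ => rfl) (by ring)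
  rw [← pow_succ']
  congr 1

theorem norm_lt_one_of_pow_lt {r : ℂ} {n : ℕ} (h : ‖r ^ n‖ < 1) : ‖r‖ < 1 := by
  by_contra! h1
  rw [norm_pow] at h
  exact absurd (one_le_pow₀ h1) h.not_ge

theorem hasSum_electricTerm {q r : ℂ} (hq : ‖q‖ < 1) (hr : r ^ 6 = q) (k : ℤ) :
    CircleIntegrable (electricIntegrand q r k) 0 1 ∧
      HasSum (fun m => r ^ (2 * k.natAbs) *
        (qBinomCoeff (r ^ 4) q m ^ 2 * ((r ^ (1 + 3 * k.natAbs)) ^ 2) ^ m))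
        (electricTerm q r k) := by
  have hr1 : ‖r‖ < 1 := norm_lt_one_of_pow_lt (n := 6) (by rwa [hr])
  have hw : ‖r ^ (1 + 3 * k.natAbs)‖ < 1 := by
    rw [norm_pow]
    exact pow_lt_one₀ (norm_nonneg _) hr1 (by omega)
  obtain ⟨h1, h2⟩ := hasSum_circleIntegral_qPochInfPM (r ^ 4) hq hw
  have e : electricIntegrand q r k = fun z => qPochInfPM (r ^ 4 * r ^ (1 + 3 * k.natAbs)) z q /
      qPochInfPM (r ^ (1 + 3 * k.natAbs)) z q / z := by
    ext z
    rw [electricIntegrand, ← pow_add]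
    congr 4
    omega
  rw [electricTerm, e]
  exact ⟨h1, h2.mul_left _⟩

theorem summable_flux_qBinomCoeff {q r : ℂ} (a : ℂ) (hq : ‖q‖ < 1) (hr : ‖r‖ < 1) :
    Summable fun p : ℤ × ℕ => r ^ (2 * p.1.natAbs) *
      (qBinomCoeff a q p.2 ^ 2 * ((r ^ (1 + 3 * p.1.natAbs)) ^ 2) ^ p.2) := by
  obtain ⟨C, hC, h⟩ := exists_norm_qBinomCoeff_le a hq
  have hr2 : ‖‖r‖ ^ 2‖ < 1 := by
    simpa using hr
  have s1 := (hasSum_pow_natAbs hr2).summable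
  have s2 := (summable_geometric_of_norm_lt_one hr2).mul_left (C ^ 2)
  refine .of_norm_bounded (s1.mul_of_nonneg s2 (fun _ => by positivity)
    (fun _ => by positivity)) fun p => ?_
  simp only [norm_mul, norm_pow, pow_mul]
  -- Decay in the flux already comes from $r^{2|k|}$, so the flux part of $w$ can be dropped,
  -- leaving a product of two geometric series.
  have h1 : ‖r‖ ^ (1 + 3 * p.1.natAbs) ≤ ‖r‖ :=
    pow_le_of_le_one (norm_nonneg _) hr.le (by omega)
  have h2 := h p.2
  gcongr

theorem hasSum_mirrorIndex {q r : ℂ} (hq : ‖q‖ < 1) (hr : r ^ 6 = q) :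
    HasSum (fun m => qBinomCoeff (r ^ 4) q m ^ 2 * (r ^ 2) ^ m *
      ((1 + r ^ 2 * q ^ m) / (1 - r ^ 2 * q ^ m))) (mirrorIndex q r) := by
  have hr1 : ‖r‖ < 1 := norm_lt_one_of_pow_lt (n := 6) (by rwa [hr])
  have hpow : ∀ n, n ≠ 0 → ‖r ^ n‖ < 1 := fun n hn => by
    rw [norm_pow]
    exact pow_lt_one₀ (norm_nonneg _) hr1 hn
  have e1 : r ^ 2 * r ^ 2 * r ^ 2 = q := by rw [← hr]; ring
  have e2 : r ^ 2 * r ^ 4 * r ^ 2 = r ^ 2 * q := by rw [← hr]; ring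
  have e3 : r ^ 2 * r ^ 4 = q := by rw [← hr]; ring
  have e4 : r ^ 2 * r ^ 2 = r ^ 4 := by ring
  have n2 := one_sub_mul_pow_ne_zero (hpow 2 (by norm_num)) hq
  have n8 : ∀ j : ℕ, 1 - r ^ 2 * q * q ^ j ≠ 0 := fun j => by
    simpa [pow_succ', mul_assoc] using n2 (j + 1)
  have n6 := one_sub_mul_pow_ne_zero hq hq
  -- Here $xcd=q$ and $xbd=xbc=r^2q$. Hence $(c;q)_m$ and $(d;q)_m$ nearly cancel against lower
  -- factors, each leaving $(1-r^2)/(1-r^2q^m)$; the prefactor $(1-r^2)^{-2}$ below removes the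
  -- constants.
  have key := hasSum_wellPoised (q := q) (b := r ^ 4) (c := r ^ 2) (d := r ^ 2) (a := r ^ 4)
    (x := r ^ 2) hq (hpow 2 (by norm_num)) (by rw [← hr]; ring) (by rwa [e1]) (by rwa [e2])
    (by rwa [e2])
  have n0 : 1 - r ^ 2 ≠ 0 := by simpa using n2 0
  refine (key.mul_left (((1 - r ^ 2) ^ 2)⁻¹)).of_eq_of_eq (fun m => ?_) ?_
  · have i1 := inv_qPoch_mul n2 m
    have i2 : qPoch (r ^ 2) q m * (qPoch (r ^ 2 * q) q m)⁻¹ =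
        (1 - r ^ 2) / (1 - r ^ 2 * q ^ m) := by
      rw [eq_div_iff (n2 m), mul_assoc, i1, mul_inv_cancel_left₀ (qPoch_ne_zero n2 m)]
    simp only [wellPoisedTerm, e1, e2, qBinomCoeff]
    calc _ = ((1 - r ^ 2) ^ 2)⁻¹ * ((1 - r ^ 4 * (q ^ m) ^ 2) * ((qPoch (r ^ 4) q m) ^ 2 *
          ((qPoch q q m)⁻¹) ^ 2 * ((1 - r ^ 2) / (1 - r ^ 2 * q ^ m)) ^ 2 * (r ^ 2) ^ m)) := by
          have := n2 m
          have h0 := qPoch_ne_zero n6 m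
          field_simp
          ring
      _ = _ := by
          rw [← i2]
          ring
  · rw [e1, e2, e3, e4, mirrorIndex, qPochInf_eq_one_sub_mul (r ^ 2) hq]
    have h6 := qPochInf_ne_zero hq n6
    have h8 := qPochInf_ne_zero hq n8
    field_simp

theorem theorem1 (q r : ℂ) (hq : ‖q‖ < 1) (hr : r ^ 6 = q) :
    (∀ k : ℤ, CircleIntegrable (electricIntegrand q r k) 0 1) ∧
      Summable (electricTerm q r) ∧
      electricIndex q r = mirrorIndex q r := by
  have hr1 : ‖r‖ < 1 := norm_lt_one_of_pow_lt (n := 6) (by rwa [hr])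
  have hs := (summable_flux_qBinomCoeff (r ^ 4) hq hr1).hasSum
  have h1 := hs.prod_fiberwise fun k => (hasSum_electricTerm hq hr k).2
  have h2 := ((Equiv.prodComm ℕ ℤ).hasSum_iff.2 hs).prod_fiberwise
    (g := fun m => qBinomCoeff (r ^ 4) q m ^ 2 * (r ^ 2) ^ m *
      ((1 + r ^ 2 * q ^ m) / (1 - r ^ 2 * q ^ m))) fun m => by
    have hy : ‖r ^ 2 * q ^ m‖ < 1 := by
      refine (norm_mul_pow_le _ hq m).trans_lt ?_
      rw [norm_pow]
      exact pow_lt_one₀ (norm_nonneg _) hr1 two_ne_zero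
    -- Since $r^6=q$, $r^{2|k|}\,r^{2m(1+3|k|)}=r^{2m}(r^2q^m)^{|k|}$.
    refine ((hasSum_pow_natAbs hy).mul_left (qBinomCoeff (r ^ 4) q m ^ 2 * (r ^ 2) ^ m)).of_eq_of_eq
      (fun k => ?_) rfl
    simp only [Function.comp_apply, Equiv.prodComm_apply, Prod.swap, ← hr]
    ring
  refine ⟨fun k => (hasSum_electricTerm hq hr k).1, h1.summable, ?_⟩
  rw [electricIndex, h1.tsum_eq]
  exact h2.unique (hasSum_mirrorIndex hq hr)
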